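/- **Conventions.** Let $\mathbb K\in\{\mathbb R,\mathbb C\}$. A set $A$ in a topological space $Y$ is $k$-closed if $p^{-1}(A)$ is closed for every continuous $p:K\to Y$ with $K$ compact Hausdorff; $Y$ is a $k$-space if every $k$-closed set is closed, and the $k$-ification $kY$ is the set $Y$ with the topology whose closed sets are the $k$-closed sets of $Y$. A linear $hk$-space is a $\mathbb K$-vector space $V$ with a topology making it a $k$-space, such that the diagonal is closed in $k(V\times V)$ and addition $k(V\times V)\to V$ and scalar multiplication $k(\mathbb K\times V)\to V$ are continuous. For topological spaces $X,Y$, $C(X,Y)$ denotes the set of continuous maps with the $k$-ification of the topology generated by the sets $\{f : f(p(K))\subseteq U\}$, where $p:K\to X$ is continuous, $K$ is compact Hausdorff and $U\subseteq Y$ is open; write $C(X)=C(X,\mathbb K)$. The natural dual $V^\wedge\subseteq C(V)$ is the closed subspace of linear functionals. A *paired linear $hk$-space* is a linear $hk$-space $V$ together with a closed linear subspace $V^*\subseteq V^\wedge$ such that $V\to (V^*)^\wedge$, $x\mapsto(\varphi\mapsto\varphi(x))$, is a closed embedding. A morphism $V\to W$ is a continuous linear map $f$ with $\varphi\circ f\in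 V^*$ for all $\varphi\in W^*$. For a topological space $X$, let $M_c(X)\subseteq C(C(X))$ be the closed linear span of the functionals $\delta_x:f\mapsto f(x)$, $x\in X$, paired with its full natural dual; it is the free paired linear $hk$-space on $X$. For a paired linear $hk$-space $V$, let $\int: M_c(V)\to V$ be the unique morphism with $\int\delta_v=v$ for all $v\in V$. For $\mu\in M_c(X)$ and a continuous $f:X\to V$, the *monadic integral* is $\int f\,d\mu:=\int (f_*\mu)$, where $(f_*\mu)(g)=\mu(g\circ f)$. For a continuous curve $\gamma:[0,1]\to V$ and $t\in[0,1]$, $\int_0^t\gamma(s)\,ds$ is the monadic integral of $\gamma$ against Lebesgue measure on $[0,t]$, viewed as the element $g\mapsto\int_0^t g(s)\,ds$ of $M_c([0,1])$. A continuous curve $\gamma:[0,1]\to V$ is *continuously differentiable* if for all $t\in(0,1)$ the limit $\gamma'(t)=\lim_{h\to0}\frac{\gamma(t+h)-\gamma(t)}{h}$ exists in $V$, and $\gamma'$ extends to a continuous curve $[0,1]\to V$, again denoted $\gamma'$ and called the derivative of $\gamma$. **Proposition (Fundamental theorem of calculus).** Let $V$ be a paired linear $hk$-space. 1. If $\gamma:[0,1]\to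 V$ is continuously differentiable, then for all $t\in[0,1]$, $$\int_0^t\gamma'(s)\,ds=\gamma(t)-\gamma(0).$$ 2. Conversely, if $\gamma:[0,1]\to V$ is continuous, then the curve $[0,1]\to V$, $t\mapsto\int_0^t\gamma(s)\,ds$, is continuously differentiable (in particular continuous) with derivative $\gamma$. -/

import Mathlib

open Topology TopologicalSpace Set Filter MeasureTheory

universe u w v z

namespace HK

/-! ### `k`-spaces and `k`-ification

The `k`-ification of a topology is `TopologicalSpace.compactlyGenerated.{u}`; a `k`-space is a space
with `UCompactlyGeneratedSpace.{u}`. Test spaces are the compact Hausdorff spaces in `Type u`. -/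

theorem locallyCompactSpace_of_compact_t2 (K : Type u) [TopologicalSpace K] [CompactSpace K]
    [T2Space K] : LocallyCompactSpace K := inferInstance

theorem continuous_to_kification {A : Type w} [t : TopologicalSpace A] {S : CompHaus.{u}}
    {φ : S → A} : Continuous[_, compactlyGenerated.{u} A] φ ↔ Continuous φ := by
  constructor
  · intro h
    refine continuous_le_rng ?_ h
    rw [← continuous_id_iff_le]
    exact @continuous_from_compactlyGenerated.{u} _ _ t t _ fun S g => g.2
  · intro h
    have h1 : Continuous[_, compactlyGenerated.{u} A]
        ((fun x : (Σ (i : (S : CompHaus.{u}) × C(S, A)), i.fst) => x.1.2 x.2) ∘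
          fun s : S => ⟨⟨S, ⟨φ, h⟩⟩, s⟩) :=
      @Continuous.comp _ _ _ _ _ (compactlyGenerated.{u} A) _ _
        continuous_coinduced_rng
        (continuous_sigmaMk (σ := fun i : (S : CompHaus.{u}) × C(S, A) => i.fst)
          (i := ⟨S, ⟨φ, h⟩⟩))
    exact h1

theorem continuous_from_kification {A : Type w} {B : Type z} [TopologicalSpace A]
    {t : TopologicalSpace B} {f : A → B} :
    Continuous[compactlyGenerated.{u} A, t] f ↔
      ∀ (S : CompHaus.{u}) (g : C(S, A)), Continuous (f ∘ g) := by
  constructor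
  · intro h S g
    exact @Continuous.comp _ _ _ _ (compactlyGenerated.{u} A) _ _ _ h
      (continuous_to_kification.2 g.2)
  · exact continuous_from_compactlyGenerated f

theorem kSpace_of_kification {A : Type w} [t : TopologicalSpace A] :
    @UCompactlyGeneratedSpace.{u} A (compactlyGenerated.{u} A) := by
  refine @uCompactlyGeneratedSpace_of_continuous_maps.{u} A (compactlyGenerated.{u} A) ?_
  intro Y tY f h
  refine continuous_from_kification.2 fun S g => ?_
  exact h S (@ContinuousMap.mk _ _ _ (compactlyGenerated.{u} A) g
    (continuous_to_kification.2 g.2))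

theorem kSpace_of_isClosed {A : Type w} [TopologicalSpace A] (hA : UCompactlyGeneratedSpace.{u} A)
    {F : Set A} (hF : IsClosed F) : UCompactlyGeneratedSpace.{u} F := by
  refine uCompactlyGeneratedSpace_of_isClosed fun s hs => ?_
  have : IsClosed (Subtype.val '' s) := by
    refine UCompactlyGeneratedSpace.isClosed fun S f => ?_
    have hT : IsClosed (f ⁻¹' F) := hF.preimage f.2
    have : CompactSpace (f ⁻¹' F) := isCompact_iff_compactSpace.1 hT.isCompact
    have h1 := hs (CompHaus.of (f ⁻¹' F))
      ⟨fun x => ⟨f x.1, x.2⟩, (f.2.comp continuous_subtype_val).subtype_mk _⟩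
    have h2 := hT.isClosedEmbedding_subtypeVal.isClosedMap _ h1
    convert h2 using 1
    ext x
    constructor
    · rintro ⟨y, hy, hxy⟩
      have hx : f x ∈ F := hxy ▸ y.2
      refine ⟨⟨x, hx⟩, ?_, rfl⟩
      have hy' : y = ⟨f x, hx⟩ := Subtype.ext hxy
      change (⟨f x, hx⟩ : F) ∈ s
      rwa [← hy']
    · rintro ⟨y, hy, rfl⟩
      exact ⟨_, hy, rfl⟩
  convert this.preimage continuous_subtype_val
  exact (Set.preimage_image_eq _ Subtype.val_injective).symm

/-! ### Spaces of continuous maps -/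

/-- The set `C(X, Y)` of continuous maps. It carries below the topology of the mapping space in the
category of `k`-spaces, which differs from Mathlib's compact-open topology, so that it is a type of
its own. The universe `u` is the one of the compact Hausdorff test spaces. -/
def KMap (X : Type w) (Y : Type v) [TopologicalSpace X] [TopologicalSpace Y] :
    Type (max u w v) := ULift.{u} C(X, Y)

namespace KMap

section
variable {X : Type w} {Y : Type v} [TopologicalSpace X] [TopologicalSpace Y]

instance : FunLike (KMap.{u} X Y) X Y where
  coe f := f.down
  coe_injective _ _ h := ULift.down_injective (DFunLike.coe_injective h)

instance : ContinuousMapClass (KMap.{u} X Y) X Y where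
  map_continuous f := f.down.continuous

@[ext] theorem ext {f g : KMap.{u} X Y} (h : ∀ x, f x = g x) : f = g := DFunLike.ext f g h

/-- A continuous function as an element of the space of continuous maps. -/
def mk (f : X → Y) (hf : Continuous f) : KMap.{u} X Y := ⟨⟨f, hf⟩⟩

@[simp] theorem mk_apply (f : X → Y) (hf : Continuous f) (x : X) : (mk.{u} f hf) x = f x := rfl

/-- The compact-open topology, generated by the sets `W(i, K, U) = {f | f (i K) ⊆ U}` with `K` compact
Hausdorff, `i : K → X` continuous and `U ⊆ Y` open. -/
abbrev compactOpen (X : Type w) (Y : Type v) [TopologicalSpace X] [TopologicalSpace Y] :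
    TopologicalSpace (KMap.{u} X Y) :=
  generateFrom {W | ∃ (K : CompHaus.{u}) (i : C(K, X)) (U : Set Y), IsOpen U ∧
    W = {f : KMap.{u} X Y | ∀ k, f (i k) ∈ U}}

/-- The `k`-ification of the compact-open topology. -/
instance : TopologicalSpace (KMap.{u} X Y) :=
  @TopologicalSpace.compactlyGenerated.{u} (KMap.{u} X Y) (compactOpen.{u} X Y)

theorem kSpace : UCompactlyGeneratedSpace.{u} (KMap.{u} X Y) :=
  @kSpace_of_kification.{u} _ (compactOpen.{u} X Y)

theorem continuous_to_iff {S : CompHaus.{u}} {φ : S → KMap.{u} X Y} :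
    Continuous φ ↔ ∀ (K : CompHaus.{u}) (i : C(K, X)),
      Continuous fun p : S × K => φ p.1 (i p.2) := by
  refine (@continuous_to_kification.{u} _ (compactOpen.{u} X Y) S φ).trans ?_
  constructor
  · intro h1 K i
    have h2 : Continuous fun s : S => (φ s).down.comp i := by
      rw [ContinuousMap.continuous_compactOpen]
      intro K' hK' U hU
      have : CompactSpace K' := isCompact_iff_compactSpace.1 hK'
      have := (continuous_generateFrom_iff.1 h1) _
        ⟨CompHaus.of K', i.comp ⟨Subtype.val, continuous_subtype_val⟩, U, hU, rfl⟩
      convert this using 1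
      ext s
      simp [MapsTo]
      rfl
    have : LocallyCompactSpace K := locallyCompactSpace_of_compact_t2 K
    exact ContinuousMap.continuous_uncurry_of_continuous (X := S) (Y := K) ⟨_, h2⟩
  · intro h
    refine continuous_generateFrom_iff.2 ?_
    rintro _ ⟨K, i, U, hU, rfl⟩
    have hc := (ContinuousMap.curry ⟨_, h K i⟩).continuous
    convert (ContinuousMap.isOpen_setOfPred_mapsTo isCompact_univ hU).preimage hc using 1
    ext s
    simp [MapsTo]

theorem continuous_from_iff {Z : Type z} [TopologicalSpace Z] {F : KMap.{u} X Y → Z} :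
    Continuous F ↔ ∀ (S : CompHaus.{u}) (g : C(S, KMap.{u} X Y)), Continuous (F ∘ g) := by
  constructor
  · intro h S g
    exact h.comp g.2
  · intro h
    have := kSpace.{u} (X := X) (Y := Y)
    exact continuous_from_uCompactlyGeneratedSpace F h

/-- Evaluation at a point is continuous. -/
theorem continuous_eval (x : X) : Continuous fun f : KMap.{u} X Y => f x := by
  refine continuous_from_iff.2 fun S g => ?_
  have := continuous_to_iff.1 g.2 (CompHaus.of PUnit.{u+1}) (ContinuousMap.const _ x)
  exact this.comp (Continuous.prodMk continuous_id (continuous_const (y := PUnit.unit)))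

instance [T2Space Y] : T2Space (KMap.{u} X Y) := by
  refine T2Space.of_injective_continuous (f := fun f : KMap.{u} X Y => (f : X → Y))
    DFunLike.coe_injective (continuous_pi fun x => continuous_eval x)

/-- Precomposition with a continuous map. -/
def precomp {X' : Type z} [TopologicalSpace X'] (f : C(X', X)) (g : KMap.{u} X Y) :
    KMap.{u} X' Y := mk (g ∘ f) ((map_continuous g).comp f.2)

theorem continuous_precomp {X' : Type z} [TopologicalSpace X'] (f : C(X', X)) :
    Continuous (precomp.{u} f : KMap.{u} X Y → KMap.{u} X' Y) := by
  refine continuous_from_iff.2 fun S g => ?_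
  refine continuous_to_iff.2 fun K i => ?_
  exact continuous_to_iff.1 g.2 K (f.comp i)

/-- The evaluation map from a `k`-space to the double function space. -/
theorem continuous_evalMap (hX : UCompactlyGeneratedSpace.{u} X) :
    Continuous fun x : X => (mk.{u} (fun f : KMap.{u} X Y => f x) (continuous_eval x)) := by
  refine continuous_from_uCompactlyGeneratedSpace _ fun S g => ?_
  refine continuous_to_iff.2 fun K i => ?_
  have := continuous_to_iff.1 i.2 S g
  exact this.comp continuous_swap

end

section Linear
variable {X : Type w} [TopologicalSpace X] {𝕜 : Type v} [RCLike 𝕜]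

instance : AddCommGroup (KMap.{u} X 𝕜) := inferInstanceAs (AddCommGroup (ULift C(X, 𝕜)))
instance : Module 𝕜 (KMap.{u} X 𝕜) := inferInstanceAs (Module 𝕜 (ULift C(X, 𝕜)))

@[simp] theorem add_apply (f g : KMap.{u} X 𝕜) (x : X) : (f + g) x = f x + g x := rfl
@[simp] theorem smul_apply (a : 𝕜) (f : KMap.{u} X 𝕜) (x : X) : (a • f) x = a * f x := rfl
@[simp] theorem zero_apply (x : X) : (0 : KMap.{u} X 𝕜) x = 0 := rfl
end Linear

end KMap

/-! ### Linear `hk`-spaces and paired linear `hk`-spaces -/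

/-- `V` is a linear `hk`-space over `𝕜`: a vector space with a topology that makes it a `k`-space,
such that the diagonal is closed in the `k`-product `k(V × V)` and such that addition and scalar
multiplication are continuous on the `k`-products `k(V × V)` and `k(𝕜 × V)`. -/
structure IsLinearHKSpace (𝕜 : Type v) (V : Type w) [RCLike 𝕜] [AddCommGroup V] [Module 𝕜 V]
    [TopologicalSpace V] : Prop where
  kSpace : UCompactlyGeneratedSpace.{u} V
  kHausdorff : IsClosed[compactlyGenerated.{u} (V × V)] (Set.diagonal V)
  continuous_add : Continuous[compactlyGenerated.{u} (V × V), inferInstance]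
    fun p : V × V => p.1 + p.2
  continuous_smul : Continuous[compactlyGenerated.{u} (𝕜 × V), inferInstance]
    fun p : 𝕜 × V => p.1 • p.2

theorem KMap.isLinearHKSpace (X : Type w) [TopologicalSpace X] (𝕜 : Type v) [RCLike 𝕜] :
    IsLinearHKSpace.{u} 𝕜 (KMap.{u} X 𝕜) where
  kSpace := KMap.kSpace
  kHausdorff := by
    have : Continuous[compactlyGenerated.{u} (KMap.{u} X 𝕜 × KMap.{u} X 𝕜), inferInstance]
        (id : KMap.{u} X 𝕜 × KMap.{u} X 𝕜 → _) :=
      continuous_from_kification.2 fun S g => g.2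
    exact @IsClosed.preimage _ _ (compactlyGenerated.{u} _) _ _ this _ isClosed_diagonal
  continuous_add := by
    refine continuous_from_kification.2 fun S g => ?_
    refine KMap.continuous_to_iff.2 fun K i => ?_
    have h1 := KMap.continuous_to_iff.1 (continuous_fst.comp g.2) K i
    have h2 := KMap.continuous_to_iff.1 (continuous_snd.comp g.2) K i
    exact h1.add h2
  continuous_smul := by
    refine continuous_from_kification.2 fun S g => ?_
    refine KMap.continuous_to_iff.2 fun K i => ?_
    have h1 := (continuous_fst.comp g.2)
    have h2 := KMap.continuous_to_iff.1 (continuous_snd.comp g.2) K i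
    exact (h1.comp continuous_fst).mul h2

theorem IsLinearHKSpace.submodule {𝕜 : Type v} {V : Type w} [RCLike 𝕜] [AddCommGroup V]
    [Module 𝕜 V] [TopologicalSpace V] (hV : IsLinearHKSpace.{u} 𝕜 V) (W : Submodule 𝕜 V)
    (hW : IsClosed (W : Set V)) : IsLinearHKSpace.{u} 𝕜 W where
  kSpace := kSpace_of_isClosed hV.kSpace hW
  kHausdorff := by
    have : Continuous[compactlyGenerated.{u} (W × W), compactlyGenerated.{u} (V × V)]
        (Prod.map Subtype.val Subtype.val) := by
      refine continuous_from_kification.2 fun S g => continuous_to_kification.2 ?_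
      exact (continuous_subtype_val.prodMap continuous_subtype_val).comp g.2
    convert @IsClosed.preimage _ _ (compactlyGenerated.{u} (W × W))
      (compactlyGenerated.{u} (V × V)) _ this _ hV.kHausdorff
    ext ⟨x, y⟩
    simp
  continuous_add := by
    refine continuous_from_kification.2 fun S g => ?_
    refine Continuous.subtype_mk (continuous_from_kification.1 hV.continuous_add S
      ⟨fun s => ((g s).1.1, (g s).2.1), ?_⟩) _
    exact (continuous_subtype_val.comp (continuous_fst.comp g.2)).prodMk
      (continuous_subtype_val.comp (continuous_snd.comp g.2))
  continuous_smul := by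
    refine continuous_from_kification.2 fun S g => ?_
    refine Continuous.subtype_mk (continuous_from_kification.1 hV.continuous_smul S
      ⟨fun s => ((g s).1, (g s).2.1), ?_⟩) _
    exact (continuous_fst.comp g.2).prodMk
      (continuous_subtype_val.comp (continuous_snd.comp g.2))

section Dual
variable (𝕜 : Type v) (V : Type w) [RCLike 𝕜] [AddCommGroup V] [Module 𝕜 V] [TopologicalSpace V]

/-- The natural dual `V^∧`: the continuous linear functionals, as a subspace of the space of all
continuous functions on `V` (with the subspace topology; it is closed, see below). -/
def naturalDual : Submodule 𝕜 (KMap.{u} V 𝕜) where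
  carrier := {f | ∀ (a : 𝕜) (x y : V), f (a • x + y) = a * f x + f y}
  zero_mem' := by intro a x y; simp
  add_mem' := by
    intro f g hf hg a x y
    simp only [KMap.add_apply, hf a x y, hg a x y]; ring
  smul_mem' := by
    intro c f hf a x y
    simp only [KMap.smul_apply, hf a x y]; ring

theorem isClosed_naturalDual : IsClosed (naturalDual.{u} 𝕜 V : Set (KMap.{u} V 𝕜)) := by
  have : (naturalDual.{u} 𝕜 V : Set (KMap.{u} V 𝕜)) =
      ⋂ (a : 𝕜) (x : V) (y : V), {f | f (a • x + y) = a * f x + f y} := by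
    ext f
    simp only [Set.mem_iInter]
    rfl
  rw [this]
  refine isClosed_iInter fun a => isClosed_iInter fun x => isClosed_iInter fun y => ?_
  exact isClosed_eq (KMap.continuous_eval _)
    ((continuous_const.mul (KMap.continuous_eval _)).add (KMap.continuous_eval _))

variable {𝕜 V}

theorem naturalDual.map_add {f : KMap.{u} V 𝕜} (hf : f ∈ naturalDual.{u} 𝕜 V) (x y : V) :
    f (x + y) = f x + f y := by simpa using hf 1 x y

theorem naturalDual.map_zero {f : KMap.{u} V 𝕜} (hf : f ∈ naturalDual.{u} 𝕜 V) : f 0 = 0 := by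
  simpa using hf 1 0 0

theorem naturalDual.map_smul {f : KMap.{u} V 𝕜} (hf : f ∈ naturalDual.{u} 𝕜 V) (a : 𝕜) (x : V) :
    f (a • x) = a * f x := by simpa [naturalDual.map_zero hf] using hf a x 0

/-- For a subspace `W` of functions on `V`, the map `V → W^∧`, `x ↦ (φ ↦ φ x)`. -/
def toDualDual (W : Submodule 𝕜 (KMap.{u} V 𝕜)) (x : V) :
    naturalDual.{u} 𝕜 W :=
  ⟨KMap.mk (fun φ : W => (φ : KMap.{u} V 𝕜) x)
    ((KMap.continuous_eval x).comp continuous_subtype_val), fun _ _ _ => rfl⟩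

end Dual

/-- The structure of a paired linear `hk`-space on `V`: `V` is a linear `hk`-space, together with a
closed linear subspace `V^*` of the natural dual `V^∧` such that `V → (V^*)^∧`, `x ↦ (φ ↦ φ x)`, is
a closed embedding. (As `V^∧` is closed in the space of all continuous functions on `V`, being
closed in the one is the same as being closed in the other.) -/
structure PairedLinearHKSpace (𝕜 : Type v) (V : Type w) [RCLike 𝕜] [AddCommGroup V] [Module 𝕜 V]
    [TopologicalSpace V] where
  isLinearHKSpace : IsLinearHKSpace.{u} 𝕜 V
  /-- The dual `V^*`. -/
  dual : Submodule 𝕜 (KMap.{u} V 𝕜)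
  dual_le : dual ≤ naturalDual.{u} 𝕜 V
  isClosed_dual : IsClosed (dual : Set (KMap.{u} V 𝕜))
  isClosedEmbedding : IsClosedEmbedding (toDualDual dual)


section Morphism
variable {𝕜 : Type v} [RCLike 𝕜] {V : Type w} [AddCommGroup V] [Module 𝕜 V] [TopologicalSpace V]
  {W : Type z} [AddCommGroup W] [Module 𝕜 W] [TopologicalSpace W]

/-- A morphism of paired linear `hk`-spaces: a continuous linear map `f : V → W` with
`φ ∘ f ∈ V^*` for all `φ ∈ W^*`. -/
structure PairedLinearHKSpace.Hom (P : PairedLinearHKSpace.{u} 𝕜 V)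
    (Q : PairedLinearHKSpace.{u} 𝕜 W) extends V →L[𝕜] W where
  adjoint_mem : ∀ φ ∈ Q.dual, KMap.precomp.{u} (toContinuousLinearMap : C(V, W)) φ ∈ P.dual

instance (P : PairedLinearHKSpace.{u} 𝕜 V) (Q : PairedLinearHKSpace.{u} 𝕜 W) :
    FunLike (P.Hom Q) V W where
  coe f := f.toContinuousLinearMap
  coe_injective f g h := by
    cases f; cases g
    congr
    exact DFunLike.coe_injective h

namespace PairedLinearHKSpace
variable (P : PairedLinearHKSpace.{u} 𝕜 V)

/-- The embedding of `V` into the space of all continuous functions on the dual. -/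
theorem isClosedEmbedding_val :
    IsClosedEmbedding fun x : V => (toDualDual.{u} P.dual x : KMap.{u} P.dual 𝕜) :=
  (isClosed_naturalDual.{u} 𝕜 P.dual).isClosedEmbedding_subtypeVal.comp P.isClosedEmbedding

theorem t2Space (P : PairedLinearHKSpace.{u} 𝕜 V) : T2Space V :=
  P.isClosedEmbedding_val.isEmbedding.t2Space

theorem toDualDual_add (x y : V) :
    (toDualDual.{u} P.dual (x + y) : KMap.{u} P.dual 𝕜) =
      toDualDual.{u} P.dual x + toDualDual.{u} P.dual y := by
  ext φ
  exact naturalDual.map_add (P.dual_le φ.2) x y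

theorem toDualDual_smul (a : 𝕜) (x : V) :
    (toDualDual.{u} P.dual (a • x) : KMap.{u} P.dual 𝕜) =
      a • (toDualDual.{u} P.dual x : KMap.{u} P.dual 𝕜) := by
  ext φ
  exact naturalDual.map_smul (P.dual_le φ.2) a x

end PairedLinearHKSpace

end Morphism

/-! ### The free paired linear `hk`-space -/

section Mc
variable (𝕜 : Type v) [RCLike 𝕜] (X : Type w) [TopologicalSpace X]

variable {X} in
/-- The Dirac functional `f ↦ f x` on the space of continuous functions on `X`. -/
def diracFunctional (x : X) : KMap.{u} (KMap.{u} X 𝕜) 𝕜 :=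
  KMap.mk (fun f => f x) (KMap.continuous_eval x)

/-- The underlying space of the free paired linear `hk`-space `M_c(X)`: the closed linear span of the
Dirac functionals in the space of functionals on the continuous functions on `X`. -/
def Mc : Submodule 𝕜 (KMap.{u} (KMap.{u} X 𝕜) 𝕜) :=
  sInf {S | IsClosed (S : Set (KMap.{u} (KMap.{u} X 𝕜) 𝕜)) ∧ ∀ x, diracFunctional.{u} 𝕜 x ∈ S}

namespace Mc

variable {X} in
theorem dirac_mem (x : X) : diracFunctional.{u} 𝕜 x ∈ Mc.{u} 𝕜 X := by
  rw [Mc, Submodule.mem_sInf]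
  exact fun S hS => hS.2 x

variable {X} in
/-- The Dirac measure `δ_x`, as an element of `M_c(X)`. -/
def dirac (x : X) : Mc.{u} 𝕜 X := ⟨diracFunctional.{u} 𝕜 x, dirac_mem 𝕜 x⟩

theorem isClosed : IsClosed (Mc.{u} 𝕜 X : Set (KMap.{u} (KMap.{u} X 𝕜) 𝕜)) := by
  rw [Mc, Submodule.coe_sInf]
  exact isClosed_biInter fun S hS => hS.1

variable {𝕜 X} in
theorem le_of_isClosed {S : Submodule 𝕜 (KMap.{u} (KMap.{u} X 𝕜) 𝕜)}
    (hS : IsClosed (S : Set (KMap.{u} (KMap.{u} X 𝕜) 𝕜)))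
    (h : ∀ x, diracFunctional.{u} 𝕜 x ∈ S) : Mc.{u} 𝕜 X ≤ S := sInf_le ⟨hS, h⟩

theorem le_naturalDual : Mc.{u} 𝕜 X ≤ naturalDual.{u} 𝕜 (KMap.{u} X 𝕜) :=
  le_of_isClosed (isClosed_naturalDual.{u} 𝕜 _) fun _ _ _ _ => rfl

/-- The map `g ↦ (μ ↦ μ g)` from the continuous functions on `X` to the natural dual of `M_c(X)`. -/
def pairing (g : KMap.{u} X 𝕜) : naturalDual.{u} 𝕜 (Mc.{u} 𝕜 X) :=
  ⟨KMap.mk (fun μ : Mc.{u} 𝕜 X => (μ : KMap.{u} (KMap.{u} X 𝕜) 𝕜) g)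
    ((KMap.continuous_eval g).comp continuous_subtype_val), fun _ _ _ => rfl⟩

theorem continuous_pairing : Continuous (pairing.{u} 𝕜 X) :=
  ((KMap.continuous_precomp.{u} ⟨Subtype.val, continuous_subtype_val⟩).comp
    (KMap.continuous_evalMap KMap.kSpace)).subtype_mk _

/-- `M_c(X)` as a paired linear `hk`-space, with the whole natural dual as its dual. -/
def paired : PairedLinearHKSpace.{u} 𝕜 (Mc.{u} 𝕜 X) where
  isLinearHKSpace := (KMap.isLinearHKSpace.{u} (KMap.{u} X 𝕜) 𝕜).submodule _ (isClosed 𝕜 X)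
  dual := naturalDual.{u} 𝕜 (Mc.{u} 𝕜 X)
  dual_le := le_refl _
  isClosed_dual := isClosed_naturalDual.{u} 𝕜 _
  isClosedEmbedding := by
    have hk := ((KMap.isLinearHKSpace.{u} (KMap.{u} X 𝕜) 𝕜).submodule _ (isClosed 𝕜 X)).kSpace
    have h1 : Continuous (toDualDual.{u} (naturalDual.{u} 𝕜 (Mc.{u} 𝕜 X))) :=
      ((KMap.continuous_precomp.{u} ⟨Subtype.val, continuous_subtype_val⟩).comp
        (KMap.continuous_evalMap hk)).subtype_mk _
    have h2 : Continuous fun χ : naturalDual.{u} 𝕜 (naturalDual.{u} 𝕜 (Mc.{u} 𝕜 X)) =>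
        KMap.precomp.{u} ⟨pairing.{u} 𝕜 X, continuous_pairing 𝕜 X⟩ (χ : KMap.{u} _ 𝕜) :=
      (KMap.continuous_precomp _).comp continuous_subtype_val
    have h3 : IsProperMap (Subtype.val : Mc.{u} 𝕜 X → KMap.{u} (KMap.{u} X 𝕜) 𝕜) :=
      (isClosed 𝕜 X).isClosedEmbedding_subtypeVal.isProperMap
    have h4 := isProperMap_of_comp_of_t2 h1 h2 h3
    refine IsClosedEmbedding.of_continuous_injective_isClosedMap h1 ?_ h4.isClosedMap
    intro μ ν h
    exact Subtype.val_injective (KMap.ext fun g =>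
      DFunLike.congr_fun (congrArg Subtype.val h) (pairing.{u} 𝕜 X g))

section Lift
variable {𝕜 X} {V : Type z} [AddCommGroup V] [Module 𝕜 V] [TopologicalSpace V]

theorem exists_weak_integral (P : PairedLinearHKSpace.{u} 𝕜 V) (f : C(X, V)) (μ : Mc.{u} 𝕜 X) :
    ∃ v : V, ∀ φ ∈ P.dual, φ v = (μ : KMap.{u} (KMap.{u} X 𝕜) 𝕜) (KMap.precomp.{u} f φ) := by
  have hr : Continuous fun φ : P.dual => KMap.precomp.{u} f (φ : KMap.{u} V 𝕜) :=
    (KMap.continuous_precomp f).comp continuous_subtype_val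
  let S : Submodule 𝕜 (KMap.{u} (KMap.{u} X 𝕜) 𝕜) :=
    { carrier := (fun ν => KMap.precomp.{u} ⟨_, hr⟩ ν) ⁻¹'
        Set.range fun x : V => (toDualDual.{u} P.dual x : KMap.{u} P.dual 𝕜)
      zero_mem' := ⟨0, by ext φ; exact naturalDual.map_zero (P.dual_le φ.2)⟩
      add_mem' := by
        rintro ν₁ ν₂ ⟨x, hx⟩ ⟨y, hy⟩
        refine ⟨x + y, ?_⟩
        change (toDualDual.{u} P.dual (x + y) : KMap.{u} P.dual 𝕜) = _
        rw [P.toDualDual_add]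
        exact congrArg₂ (· + ·) hx hy
      smul_mem' := by
        rintro a ν ⟨x, hx⟩
        refine ⟨a • x, ?_⟩
        change (toDualDual.{u} P.dual (a • x) : KMap.{u} P.dual 𝕜) = _
        rw [P.toDualDual_smul]
        exact congrArg (a • ·) hx }
  have hS : Mc.{u} 𝕜 X ≤ S :=
    le_of_isClosed (P.isClosedEmbedding_val.isClosed_range.preimage (KMap.continuous_precomp _))
      fun x => ⟨f x, rfl⟩
  obtain ⟨v, hv⟩ := hS μ.2
  exact ⟨v, fun φ hφ => DFunLike.congr_fun hv (⟨φ, hφ⟩ : P.dual)⟩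

/-- The universal property: `M_c(X)` is the free paired linear `hk`-space on `X`. -/
theorem existsUnique_lift (P : PairedLinearHKSpace.{u} 𝕜 V) (f : C(X, V)) :
    ∃! F : (paired.{u} 𝕜 X).Hom P, ∀ x, F (dirac.{u} 𝕜 x) = f x := by
  have hsep : ∀ x y : V, (∀ φ ∈ P.dual, φ x = φ y) → x = y := fun x y h =>
    P.isClosedEmbedding_val.injective (KMap.ext fun φ => h φ φ.2)
  choose F hF using exists_weak_integral P f
  have hr : Continuous fun φ : P.dual => KMap.precomp.{u} f (φ : KMap.{u} V 𝕜) :=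
    (KMap.continuous_precomp f).comp continuous_subtype_val
  let L : Mc.{u} 𝕜 X →L[𝕜] V :=
    { toFun := F
      map_add' := fun μ ν => hsep _ _ fun φ hφ => by
        rw [naturalDual.map_add (P.dual_le hφ), hF _ φ hφ, hF _ φ hφ, hF _ φ hφ]; rfl
      map_smul' := fun a μ => hsep _ _ fun φ hφ => by
        rw [RingHom.id_apply, naturalDual.map_smul (P.dual_le hφ), hF _ φ hφ, hF _ φ hφ]; rfl
      cont := by
        refine P.isClosedEmbedding_val.isEmbedding.continuous_iff.2 ?_
        have : Continuous fun μ : Mc.{u} 𝕜 X => KMap.precomp.{u} ⟨_, hr⟩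
            (μ : KMap.{u} (KMap.{u} X 𝕜) 𝕜) :=
          (KMap.continuous_precomp _).comp continuous_subtype_val
        convert this using 1
        ext μ φ
        exact hF μ φ φ.2 }
  refine ⟨⟨L, fun φ hφ a μ ν => ?_⟩, fun x => hsep _ _ fun φ hφ => hF _ φ hφ, ?_⟩
  · change φ (L (a • μ + ν)) = a * φ (L μ) + φ (L ν)
    rw [L.map_add, L.map_smul]
    exact P.dual_le hφ a _ _
  · intro G hG
    have := P.t2Space
    let E : Submodule 𝕜 (Mc.{u} 𝕜 X) :=
      LinearMap.eqLocus G.toContinuousLinearMap.toLinearMap L.toLinearMap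
    have hE : IsClosed (E : Set (Mc.{u} 𝕜 X)) :=
      isClosed_eq G.toContinuousLinearMap.continuous L.continuous
    have hle : Mc.{u} 𝕜 X ≤ E.map (Mc.{u} 𝕜 X).subtype := by
      refine le_of_isClosed ?_ fun x => ⟨dirac.{u} 𝕜 x, ?_, rfl⟩
      · rw [Submodule.map_coe]
        exact (isClosed 𝕜 X).isClosedEmbedding_subtypeVal.isClosedMap _ hE
      · exact (hG x).trans (hsep _ _ fun φ hφ => (hF (dirac.{u} 𝕜 x) φ hφ).symm)
    refine DFunLike.ext _ _ fun μ => ?_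
    obtain ⟨ν, hν, h⟩ := hle μ.2
    have : ν = μ := Subtype.val_injective h
    exact this ▸ hν

/-- The integral `∫ : M_c(V) → V` of a paired linear `hk`-space `V`: the unique morphism of paired
linear `hk`-spaces that extends the identity, i.e. that sends `δ_v` to `v` for all `v`. -/
noncomputable def integral (P : PairedLinearHKSpace.{u} 𝕜 V) : (paired.{u} 𝕜 V).Hom P :=
  (existsUnique_lift P (ContinuousMap.id V)).choose

end Lift

section Map
variable {X} {Y : Type z} [TopologicalSpace Y]

/-- The pushforward of functionals, `(f_* μ)(g) = μ(g ∘ f)`, maps `M_c(X)` to `M_c(Y)`. -/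
theorem map_mem (f : C(X, Y)) (μ : Mc.{u} 𝕜 X) :
    KMap.precomp.{u} ⟨KMap.precomp.{u} f, KMap.continuous_precomp f⟩ μ.1 ∈ Mc.{u} 𝕜 Y := by
  let S : Submodule 𝕜 (KMap.{u} (KMap.{u} X 𝕜) 𝕜) :=
    { carrier := KMap.precomp.{u} ⟨KMap.precomp.{u} f, KMap.continuous_precomp f⟩ ⁻¹'
        (Mc.{u} 𝕜 Y)
      zero_mem' := (Mc.{u} 𝕜 Y).zero_mem
      add_mem' := fun h₁ h₂ => (Mc.{u} 𝕜 Y).add_mem h₁ h₂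
      smul_mem' := fun a _ h => (Mc.{u} 𝕜 Y).smul_mem a h }
  have : Mc.{u} 𝕜 X ≤ S := le_of_isClosed
    ((isClosed 𝕜 Y).preimage (KMap.continuous_precomp _)) fun x => dirac_mem 𝕜 (f x)
  exact this μ.2

/-- The pushforward `f_* : M_c(X) → M_c(Y)`, `(f_* μ)(g) = μ(g ∘ f)`. It is the morphism that sends
`δ_x` to `δ_{f x}`. -/
def map (f : C(X, Y)) : (paired.{u} 𝕜 X).Hom (paired.{u} 𝕜 Y) where
  toFun μ := ⟨KMap.precomp.{u} ⟨KMap.precomp.{u} f, KMap.continuous_precomp f⟩ μ.1, map_mem 𝕜 f μ⟩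
  map_add' _ _ := rfl
  map_smul' _ _ := rfl
  cont := ((KMap.continuous_precomp _).comp continuous_subtype_val).subtype_mk _
  adjoint_mem := fun _ hφ a μ ν => hφ a ⟨_, map_mem 𝕜 f μ⟩ ⟨_, map_mem 𝕜 f ν⟩

theorem map_dirac (f : C(X, Y)) (x : X) :
    map.{u} 𝕜 f (dirac.{u} 𝕜 x) = dirac.{u} 𝕜 (f x) := rfl

end Map

section Measure
open unitInterval

theorem continuous_toContinuousMap :
    Continuous fun f : KMap.{u} I 𝕜 => (f : C(I, 𝕜)) := by
  refine KMap.continuous_from_iff.2 fun S g => ?_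
  have h := KMap.continuous_to_iff.1 g.2 (CompHaus.of (ULift.{u} I)) ⟨ULift.down, continuous_uliftDown⟩
  have h2 : Continuous fun p : S × I => g p.1 p.2 :=
    h.comp (continuous_fst.prodMk (continuous_uliftUp.comp continuous_snd))
  exact (ContinuousMap.curry ⟨_, h2⟩).continuous

theorem integrable_comp (μ : Measure I) [IsFiniteMeasure μ] (f : C(I, 𝕜)) {s : I → I}
    (hs : Measurable s) : Integrable (fun x => f (s x)) μ :=
  Integrable.of_bound (f.continuous.measurable.comp hs).aestronglyMeasurable ‖f‖
    (Eventually.of_forall fun x => f.norm_coe_le_norm (s x))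

theorem lipschitzWith_integral (μ : Measure I) [IsFiniteMeasure μ] {s : I → I}
    (hs : Measurable s) :
    LipschitzWith (μ.real univ).toNNReal fun f : C(I, 𝕜) => ∫ x, f (s x) ∂μ := by
  refine LipschitzWith.of_dist_le_mul fun f g => ?_
  rw [dist_eq_norm, ← integral_sub (integrable_comp 𝕜 μ f hs) (integrable_comp 𝕜 μ g hs),
    Real.coe_toNNReal _ measureReal_nonneg, mul_comm, dist_eq_norm]
  exact norm_integral_le_of_norm_le_const
    (Eventually.of_forall fun x => (f - g).norm_coe_le_norm (s x))

/-- Integration of continuous functions on `[0,1]` against a finite Borel measure. -/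
noncomputable def integralFunctional (μ : Measure I) [IsFiniteMeasure μ] :
    KMap.{u} (KMap.{u} I 𝕜) 𝕜 :=
  KMap.mk (fun f => ∫ x, f x ∂μ)
    ((lipschitzWith_integral 𝕜 μ measurable_id).continuous.comp (continuous_toContinuousMap.{u} 𝕜))

theorem integralFunctional_mem (μ : Measure I) [IsFiniteMeasure μ] :
    integralFunctional.{u} 𝕜 μ ∈ Mc.{u} 𝕜 I := by
  let a : ℕ → SimpleFunc I I := SimpleFunc.approxOn id measurable_id univ 0 (mem_univ _)
  have ha : ∀ x, Tendsto (fun n => a n x) atTop (𝓝 x) := fun x =>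
    SimpleFunc.tendsto_approxOn measurable_id _ (by simp)
  let s : OnePoint ℕ → I → I := fun p => p.elim id fun n => a n
  have hs : ∀ p, Measurable (s p) := by
    intro p
    induction p using OnePoint.rec with
    | infty => exact measurable_id
    | coe n => exact (a n).measurable
  have hc : Continuous fun q : OnePoint ℕ × C(I, 𝕜) => ∫ x, q.2 (s q.1 x) ∂μ := by
    refine continuous_prod_of_continuous_lipschitzWith' _ (μ.real univ).toNNReal
      (fun p => lipschitzWith_integral 𝕜 μ (hs p)) fun f => ?_
    refine (OnePoint.continuous_iff_from_nat _).2 ?_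
    refine tendsto_integral_of_dominated_convergence (fun _ => ‖f‖)
      (fun n => (integrable_comp 𝕜 μ f (hs n)).aestronglyMeasurable) (integrable_const _)
      (fun n => Eventually.of_forall fun x => f.norm_coe_le_norm _)
      (Eventually.of_forall fun x => (f.continuous.tendsto x).comp (ha x))
  let Λ : OnePoint ℕ → KMap.{u} (KMap.{u} I 𝕜) 𝕜 := fun p =>
    KMap.mk (fun f => ∫ x, f (s p x) ∂μ)
      ((lipschitzWith_integral 𝕜 μ (hs p)).continuous.comp (continuous_toContinuousMap.{u} 𝕜))
  have hΛ : Continuous fun p : ULift.{u} (OnePoint ℕ) => Λ p.down := by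
    refine KMap.continuous_to_iff (S := CompHaus.of (ULift.{u} (OnePoint ℕ))) |>.2 fun K i => ?_
    exact hc.comp ((continuous_uliftDown.comp continuous_fst).prodMk
      ((continuous_toContinuousMap.{u} 𝕜).comp (i.2.comp continuous_snd)))
  have hΛ' : Tendsto (fun n : ℕ => Λ n) atTop (𝓝 (Λ OnePoint.infty)) :=
    (OnePoint.continuous_iff_from_nat _).1 (hΛ.comp continuous_uliftUp)
  refine (isClosed 𝕜 I).mem_of_tendsto hΛ' (Eventually.of_forall fun n => ?_)
  have : Λ n = ∑ y ∈ (a n).range,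
      ((μ.real (a n ⁻¹' {y}) : ℝ) : 𝕜) • diracFunctional.{u} 𝕜 y := by
    ext f
    have h1 : ∀ T : Finset I, (∑ y ∈ T, ((μ.real (a n ⁻¹' {y}) : ℝ) : 𝕜) •
        diracFunctional.{u} 𝕜 y) f = ∑ y ∈ T, ((μ.real (a n ⁻¹' {y}) : ℝ) : 𝕜) * f y := by
      intro T
      induction T using Finset.induction_on with
      | empty => simp
      | insert y T hy ih =>
        rw [Finset.sum_insert hy, Finset.sum_insert hy, KMap.add_apply, ih]
        rfl
    have h2 : ∀ x, f (a n x) =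
        ∑ y ∈ (a n).range, (a n ⁻¹' {y}).indicator (fun _ => f y) x := by
      intro x
      rw [Finset.sum_eq_single (a n x)]
      · simp
      · intro y _ hy
        exact Set.indicator_of_notMem (fun h => hy h.symm) _
      · exact fun h => (h (SimpleFunc.mem_range_self _ x)).elim
    rw [h1]
    change ∫ x, f (a n x) ∂μ = _
    simp_rw [h2]
    rw [integral_finsetSum _ fun y _ =>
      (integrable_const (f y)).indicator ((a n).measurableSet_fiber y)]
    refine Finset.sum_congr rfl fun y _ => ?_
    rw [integral_indicator_const _ ((a n).measurableSet_fiber y), RCLike.real_smul_eq_coe_mul]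
  rw [this]
  exact Submodule.sum_mem _ fun y _ => Submodule.smul_mem _ _ (dirac_mem 𝕜 y)

/-- A finite Borel measure `μ` on the unit interval, as the element `f ↦ ∫ f dμ` of `M_c([0,1])`. -/
noncomputable def ofMeasure (μ : Measure I) [IsFiniteMeasure μ] : Mc.{u} 𝕜 I :=
  ⟨integralFunctional.{u} 𝕜 μ, integralFunctional_mem 𝕜 μ⟩

end Measure
end Mc
end Mc

/-! ### Integrals and derivatives of curves -/

section Curves
open unitInterval

/-- The monadic vector-valued integral `∫ f(x) dμ(x) = ∫ (f_* μ)` of a continuous map `f : X → V`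
against `μ ∈ M_c(X)`. -/
noncomputable def vectorIntegral {𝕜 : Type v} [RCLike 𝕜] {V : Type w} [AddCommGroup V] [Module 𝕜 V]
    [TopologicalSpace V] {X : Type z} [TopologicalSpace X] (P : PairedLinearHKSpace.{u} 𝕜 V)
    (f : C(X, V)) (μ : Mc.{u} 𝕜 X) : V :=
  Mc.integral P (Mc.map.{u} 𝕜 f μ)

/-- The integral `∫_0^t γ(s) ds` of a continuous curve: the monadic integral of `γ` against Lebesgue
measure restricted to `[0,t]`. -/
noncomputable def curveIntegral {𝕜 : Type v} [RCLike 𝕜] {V : Type w} [AddCommGroup V] [Module 𝕜 V]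
    [TopologicalSpace V] (P : PairedLinearHKSpace.{u} 𝕜 V) (γ : C(I, V)) (t : I) : V :=
  vectorIntegral P γ (Mc.ofMeasure.{u} 𝕜 ((volume : Measure I).restrict (Set.Icc 0 t)))

/-- The continuous curve `γ : [0,1] → V` is continuously differentiable with derivative the
continuous curve `γ' : [0,1] → V`: for all `t` in the open interval `(0,1)`, the difference quotient
`(γ(t+h) - γ(t))/h` converges to `γ'(t)` in `V` as `h → 0`, `h ≠ 0`. (`γ` is extended constantly
outside of `[0,1]`, which has no effect for small `h`.) -/
def HasContinuousDeriv (𝕜 : Type v) [RCLike 𝕜] {V : Type w} [AddCommGroup V] [Module 𝕜 V]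
    [TopologicalSpace V] (γ γ' : C(I, V)) : Prop :=
  ∀ t : I, 0 < t → t < 1 →
    Tendsto (fun h : ℝ => ((h⁻¹ : ℝ) : 𝕜) • (γ (Set.projIcc 0 1 zero_le_one (t + h)) - γ t))
      (𝓝[≠] 0) (𝓝 (γ' t))

end Curves
end HK

namespace HK
open unitInterval

/-! ### Curves extended to the real line -/

section Curve
variable {𝕜 : Type v} [RCLike 𝕜] {V : Type w} [TopologicalSpace V]

/-! The dual `V^*` separates the points of `V`, and every `φ ∈ V^*` commutes with the integral
`M_c(V) → V`: both sides of that identity are continuous and linear in the measure and agree on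
Dirac measures. Hence `φ (∫_0^t γ)` is the ordinary integral of `φ ∘ γ`
(`dual_apply_curveIntegral`), and the first statement becomes the scalar fundamental theorem of
calculus, applied to each `φ ∘ γ`.

The second statement needs convergence in the topology of `V`, so testing against one `φ` at a time
is not enough. That topology is induced by the embedding of `V` into the functions on `V^*`. In that
function space the substitution `s = t + h r` turns the difference quotient of the integral into the
average `φ ↦ ∫_0^1 φ(γ(t + h r)) dr`, for `h ≠ 0` small. The average makes sense at `h = 0` too,
where it is evaluation at `γ(t)`, so the limit follows once averages depend continuously on the
curve parameter (`continuous_average`). This holds because continuity into the function space is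
tested on compact families of functionals, over which the integrand is jointly continuous. -/

theorem continuous_dual_comp_projIcc (φ : KMap.{u} V 𝕜) (γ : C(I, V)) :
    Continuous fun s : ℝ => φ (γ (projIcc 0 1 zero_le_one s)) :=
  (map_continuous φ).comp (γ.continuous.comp continuous_projIcc)

/-- The segment `r ↦ γ(a + h r)` of a curve that is extended constantly. -/
noncomputable def segment (γ : C(I, V)) (a h : ℝ) : C(I, V) :=
  ⟨fun r => γ (projIcc 0 1 zero_le_one (a + h * r)),
    γ.continuous.comp (continuous_projIcc.comp (by fun_prop))⟩

theorem continuous_segment {S : Type*} [TopologicalSpace S] (γ : C(I, V)) (a : ℝ) {h : S → ℝ}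
    (hh : Continuous h) : Continuous fun p : S × I => segment γ a (h p.1) p.2 :=
  γ.continuous.comp (continuous_projIcc.comp (by fun_prop))

end Curve

/-! ### Testing against the dual, and the integral of a derivative -/

section Weak
variable {𝕜 : Type v} [RCLike 𝕜] {V : Type w} [AddCommGroup V] [Module 𝕜 V] [TopologicalSpace V]

theorem PairedLinearHKSpace.ext_dual (P : PairedLinearHKSpace.{u} 𝕜 V) {x y : V}
    (h : ∀ φ ∈ P.dual, φ x = φ y) : x = y :=
  P.isClosedEmbedding_val.injective (KMap.ext fun φ => h φ φ.2)

theorem naturalDual.map_sub {f : KMap.{u} V 𝕜} (hf : f ∈ naturalDual.{u} 𝕜 V) (x y : V) :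
    f (x - y) = f x - f y := by
  rw [eq_sub_iff_add_eq, ← naturalDual.map_add hf, sub_add_cancel]

/-- An element of the dual commutes with the integral `M_c(V) → V`. -/
theorem dual_apply_integral (P : PairedLinearHKSpace.{u} 𝕜 V) {φ : KMap.{u} V 𝕜}
    (hφ : φ ∈ P.dual) (μ : Mc.{u} 𝕜 V) :
    φ (Mc.integral P μ) = (μ : KMap.{u} (KMap.{u} V 𝕜) 𝕜) φ := by
  have hc : Continuous (Mc.integral P) := (Mc.integral P).toContinuousLinearMap.continuous
  -- The locus of equality is a closed subspace containing the Dirac measures, hence everything.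
  let E : Submodule 𝕜 (Mc.{u} 𝕜 V) :=
    { carrier := {μ | φ (Mc.integral P μ) = (μ : KMap.{u} (KMap.{u} V 𝕜) 𝕜) φ}
      zero_mem' := by
        change φ ((Mc.integral P).toContinuousLinearMap 0) = 0
        rw [map_zero, naturalDual.map_zero (P.dual_le hφ)]
      add_mem' := fun {a b} ha hb => by
        change φ ((Mc.integral P).toContinuousLinearMap (a + b)) = _
        rw [map_add, naturalDual.map_add (P.dual_le hφ)]
        exact congrArg₂ (· + ·) ha hb
      smul_mem' := fun c a ha => by
        change φ ((Mc.integral P).toContinuousLinearMap (c • a)) = _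
        rw [map_smul, naturalDual.map_smul (P.dual_le hφ)]
        exact congrArg (c * ·) ha }
  have hE : IsClosed (E : Set (Mc.{u} 𝕜 V)) :=
    isClosed_eq ((map_continuous φ).comp hc)
      ((KMap.continuous_eval φ).comp continuous_subtype_val)
  -- Minimality of `Mc` concerns closed subspaces of the ambient function space, so `E` is pushed
  -- forward there; its image stays closed because `Mc` is closed.
  have hle : Mc.{u} 𝕜 V ≤ E.map (Mc.{u} 𝕜 V).subtype := by
    refine Mc.le_of_isClosed ?_ fun x => ⟨Mc.dirac.{u} 𝕜 x, ?_, rfl⟩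
    · rw [Submodule.map_coe]
      exact (Mc.isClosed 𝕜 V).isClosedEmbedding_subtypeVal.isClosedMap _ hE
    · exact congrArg φ ((Mc.existsUnique_lift P (ContinuousMap.id V)).choose_spec.1 x)
  obtain ⟨ν, hν, h⟩ := hle μ.2
  have : ν = μ := Subtype.val_injective h
  exact this ▸ hν

/-- The inclusion of `I` into the line carries the measure of `I` to Lebesgue measure restricted to
`I`, and `[0,t]` and `(0,t]` differ by a null set. This gives access to the interval integral
calculus. -/
theorem setIntegral_unitInterval {E : Type*} [NormedAddCommGroup E] [NormedSpace ℝ E]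
    (g : ℝ → E) (t : I) :
    ∫ x : I in Icc 0 t, g x = ∫ s in (0 : ℝ)..t, g s := by
  rw [intervalIntegral.integral_of_le t.2.1, ← integral_Icc_eq_integral_Ioc]
  have hI : MeasurableEmbedding (Subtype.val : I → ℝ) :=
    MeasurableEmbedding.subtype_coe measurableSet_Icc
  have hpre : (Icc 0 t : Set I) = Subtype.val ⁻¹' Icc (0 : ℝ) t := by
    ext x; simp [← Subtype.coe_le_coe, x.2.1]
  have hmap : (volume : Measure I).map Subtype.val = (volume : Measure ℝ).restrict I :=
    map_comap_subtype_coe measurableSet_Icc _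
  rw [hpre, ← hI.setIntegral_map, hmap, Measure.restrict_restrict measurableSet_Icc,
    inter_eq_left.2 (Icc_subset_Icc_right t.2.2)]

theorem integral_unitInterval {E : Type*} [NormedAddCommGroup E] [NormedSpace ℝ E] (g : ℝ → E) :
    ∫ x : I, g x = ∫ s in (0 : ℝ)..1, g s := by
  have h := setIntegral_unitInterval g 1
  rwa [show (Icc 0 1 : Set I) = univ from Icc_bot_top, Measure.restrict_univ] at h

/-- The curve integral is a weak integral. -/
theorem dual_apply_curveIntegral (P : PairedLinearHKSpace.{u} 𝕜 V) {φ : KMap.{u} V 𝕜}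
    (hφ : φ ∈ P.dual) (γ : C(I, V)) (t : I) :
    φ (curveIntegral P γ t) = ∫ s in (0 : ℝ)..t, φ (γ (projIcc 0 1 zero_le_one s)) := by
  rw [← setIntegral_unitInterval fun s => φ (γ (projIcc 0 1 zero_le_one s))]
  simp only [projIcc_val]
  -- By definition of pushforward and `Mc.ofMeasure`, the value of the pushed-forward functional at
  -- `φ` is the remaining integral.
  exact dual_apply_integral P hφ _

/-- A continuously differentiable curve is the integral of its derivative. -/
theorem HasContinuousDeriv.curveIntegral_eq_sub (P : PairedLinearHKSpace.{u} 𝕜 V) {γ γ' : C(I, V)}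
    (h : HasContinuousDeriv 𝕜 γ γ') (t : I) : curveIntegral P γ' t = γ t - γ 0 := by
  refine P.ext_dual fun φ hφ => ?_
  have hlin := P.dual_le hφ
  rw [dual_apply_curveIntegral P hφ, naturalDual.map_sub hlin]
  -- This version asks for the derivative only on the open interval and for continuity up to the
  -- endpoints, which is all that `HasContinuousDeriv` provides.
  have key := intervalIntegral.integral_eq_sub_of_hasDerivAt_of_le t.2.1
    (continuous_dual_comp_projIcc φ γ).continuousOn
    (f' := fun s => φ (γ' (projIcc 0 1 zero_le_one s))) ?_
    ((continuous_dual_comp_projIcc φ γ').intervalIntegrable _ _)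
  · rw [key, projIcc_val, projIcc_left]
    rfl
  · intro x hx
    have hx1 : x < 1 := hx.2.trans_le t.2.2
    have hxI : projIcc 0 1 zero_le_one x = (⟨x, hx.1.le, hx1.le⟩ : I) :=
      projIcc_of_mem _ ⟨hx.1.le, hx1.le⟩
    rw [hasDerivAt_iff_tendsto_slope_zero]
    -- A continuous linear functional carries the limit of difference quotients in `V` to the scalar
    -- one.
    have := ((map_continuous φ).tendsto _).comp (h ⟨x, hx.1.le, hx1.le⟩ hx.1 hx1)
    rw [hxI]
    refine this.congr fun r => ?_
    simp only [Function.comp_apply]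
    rw [naturalDual.map_smul hlin, naturalDual.map_sub hlin, RCLike.real_smul_eq_coe_mul]

end Weak

/-! ### Averages over a curve, and their dependence on parameters -/

section Average
variable {𝕜 : Type v} [RCLike 𝕜] {V : Type w} [TopologicalSpace V]

/-- The functional `φ ↦ ∫_0^1 φ(c(r)) dr` for a continuous curve `c` in `V`, on a space `D` of functions
on `V`. -/
noncomputable def average (D : Set (KMap.{u} V 𝕜)) (c : C(I, V)) : KMap.{u} D 𝕜 :=
  KMap.mk (fun φ => ∫ r, φ.1 (c r)) <|
    ((Mc.lipschitzWith_integral 𝕜 (volume : Measure I) measurable_id).continuous.comp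
      (Mc.continuous_toContinuousMap.{u} 𝕜)).comp
        ((KMap.continuous_precomp c).comp continuous_subtype_val)

/-- Against a compact family of functionals, the integrand is jointly continuous in parameter,
functional and `r`. Currying makes it a continuous family in `C(I, 𝕜)` with the sup norm, on which
integration is Lipschitz. -/
theorem continuous_average (D : Set (KMap.{u} V 𝕜)) {S : CompHaus.{u}} {c : S → C(I, V)}
    (hc : Continuous fun p : S × I => c p.1 p.2) : Continuous fun p => average D (c p) := by
  refine KMap.continuous_to_iff.2 fun K i => ?_
  -- The test space is the product of the parameter space with the interval, mapped to `V` by `c`;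
  -- `ULift` only adjusts the universe.
  have h1 := KMap.continuous_to_iff.1 (continuous_subtype_val.comp i.2)
    (CompHaus.of (S × ULift.{u} I)) ⟨fun q => c q.1 q.2.down,
      hc.comp (continuous_fst.prodMk (continuous_uliftDown.comp continuous_snd))⟩
  have h2 : Continuous fun q : (S × K) × I => (i q.1.2).1 (c q.1.1 q.2) :=
    h1.comp (f := fun q : (S × K) × I => (q.1.2, (q.1.1, ULift.up q.2))) (by fun_prop)
  exact (Mc.lipschitzWith_integral 𝕜 (volume : Measure I) measurable_id).continuous.comp
    (ContinuousMap.curry ⟨_, h2⟩).continuous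

end Average

/-! ### Continuity and derivative of the integral -/

section Antiderivative
variable {𝕜 : Type v} [RCLike 𝕜] {V : Type w} [AddCommGroup V] [Module 𝕜 V] [TopologicalSpace V]

/-- Substitution `s = a + h r`. The sign of `h` is arbitrary, and both sides vanish for `h = 0`. -/
theorem smul_average_segment (P : PairedLinearHKSpace.{u} 𝕜 V) (γ : C(I, V)) (a h : ℝ)
    (φ : P.dual) : (h : 𝕜) * average (P.dual : Set (KMap.{u} V 𝕜)) (segment γ a h) φ =
      ∫ s in a..(a + h), φ.1 (γ (projIcc 0 1 zero_le_one s)) := by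
  have h1 := intervalIntegral.smul_integral_comp_add_mul (a := 0) (b := 1)
    (fun s => φ.1 (γ (projIcc 0 1 zero_le_one s))) h a
  rw [mul_zero, add_zero, mul_one] at h1
  rw [← h1, RCLike.real_smul_eq_coe_mul, ← integral_unitInterval fun x =>
    φ.1 (γ (projIcc 0 1 zero_le_one (a + h * x)))]
  rfl

/-- The moving endpoint is scaled away: in the function space on the dual, the integral is `t` times
the average of `r ↦ γ(t r)`, and both factors are continuous in `t`. -/
theorem continuous_curveIntegral (P : PairedLinearHKSpace.{u} 𝕜 V) (γ : C(I, V)) :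
    Continuous (curveIntegral P γ) := by
  refine P.isClosedEmbedding_val.isEmbedding.continuous_iff.2 ?_
  have h1 : Continuous fun t : ULift.{u} I =>
      average (P.dual : Set (KMap.{u} V 𝕜)) (segment γ 0 t.down) :=
    continuous_average (S := CompHaus.of (ULift.{u} I)) _
      (continuous_segment γ 0 (continuous_subtype_val.comp continuous_uliftDown))
  have h2 : Continuous fun t : ULift.{u} I => (((t.down : ℝ) : 𝕜) •
      (average (P.dual : Set (KMap.{u} V 𝕜)) (segment γ 0 t.down) : KMap.{u} P.dual 𝕜)) :=
    -- Scalar multiplication is given as continuous on the `k`-product, so it is composed with a map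
    -- from a compact Hausdorff space.
    continuous_from_kification.1 (KMap.isLinearHKSpace.{u} P.dual 𝕜).continuous_smul
      (CompHaus.of (ULift.{u} I)) ⟨_, ((RCLike.continuous_ofReal.comp
        (continuous_subtype_val.comp continuous_uliftDown)).prodMk h1)⟩
  convert h2.comp continuous_uliftUp using 1
  ext t φ
  refine (dual_apply_curveIntegral P φ.2 γ t).trans ?_
  have h3 := smul_average_segment P γ 0 t φ
  rw [zero_add] at h3
  exact h3.symm

theorem hasContinuousDeriv_curveIntegral (P : PairedLinearHKSpace.{u} 𝕜 V) (γ : C(I, V)) :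
    HasContinuousDeriv 𝕜 ⟨curveIntegral P γ, continuous_curveIntegral P γ⟩ γ := by
  intro t ht0 ht1
  rw [P.isClosedEmbedding_val.isEmbedding.tendsto_nhds_iff]
  let A : ℝ → KMap.{u} P.dual 𝕜 := fun h => average (P.dual : Set (KMap.{u} V 𝕜)) (segment γ t h)
  -- Continuity of averages is available over compact parameter spaces, so `h` is confined to a
  -- compact neighbourhood of `0`.
  have hA : Continuous fun h : ULift.{u} (Icc (-1 : ℝ) 1) => A h.down :=
    continuous_average (S := CompHaus.of (ULift.{u} (Icc (-1 : ℝ) 1))) _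
      (continuous_segment γ t (continuous_subtype_val.comp continuous_uliftDown))
  have h11 : (-1 : ℝ) ≤ 1 := by norm_num
  have hA' : Continuous fun h : ℝ => A (projIcc (-1 : ℝ) 1 h11 h) :=
    (hA.comp continuous_uliftUp).comp (continuous_projIcc (h := h11))
  -- At `h = 0` the segment is constant and the interval has total mass one.
  have hA0 : A 0 = toDualDual.{u} P.dual (γ t) := by
    ext φ
    change ∫ r : I, φ.1 (γ (projIcc 0 1 zero_le_one (t + 0 * r))) = φ.1 (γ t)
    simp
  have hlim := (hA'.tendsto 0).mono_left (nhdsWithin_le_nhds (s := {0}ᶜ))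
  rw [projIcc_of_mem h11 (by norm_num : (0 : ℝ) ∈ Icc (-1 : ℝ) 1), hA0] at hlim
  refine hlim.congr' ?_
  have e1 : ∀ᶠ h : ℝ in 𝓝[≠] 0, h ∈ Icc (-1 : ℝ) 1 :=
    nhdsWithin_le_nhds (Icc_mem_nhds (by norm_num) (by norm_num))
  -- As `t` is interior, `t + h` stays in `[0,1]` and the constant extension of the integral plays
  -- no role.
  have e2 : ∀ᶠ h : ℝ in 𝓝[≠] 0, (t : ℝ) + h ∈ Icc (0 : ℝ) 1 := by
    refine nhdsWithin_le_nhds ((continuous_const_add (t : ℝ)).continuousAt ?_)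
    rw [add_zero]
    exact Icc_mem_nhds ht0 ht1
  filter_upwards [e1, e2, self_mem_nhdsWithin] with h h1 h2 h0
  rw [projIcc_of_mem h11 h1]
  ext φ
  have hlin := P.dual_le φ.2
  have hint := fun a b => (continuous_dual_comp_projIcc φ.1 γ).intervalIntegrable
    (μ := volume) a b
  change A h φ = φ.1 (((h⁻¹ : ℝ) : 𝕜) •
    (curveIntegral P γ (projIcc 0 1 zero_le_one (t + h)) - curveIntegral P γ t))
  -- The two integrals from `0` differ by the oriented integral from `t` to `t + h`, which is `h`
  -- times the average; `h ≠ 0` cancels.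
  rw [projIcc_of_mem zero_le_one h2, naturalDual.map_smul hlin, naturalDual.map_sub hlin,
    dual_apply_curveIntegral P φ.2, dual_apply_curveIntegral P φ.2,
    intervalIntegral.integral_interval_sub_left (hint _ _)
    (hint _ _), ← smul_average_segment P γ t h φ, ← mul_assoc, ← RCLike.ofReal_mul,
    inv_mul_cancel₀ h0, RCLike.ofReal_one, one_mul]

end Antiderivative
end HK

theorem mainTheorem12 {𝕜 : Type v} [RCLike 𝕜] {V : Type u} [AddCommGroup V] [Module 𝕜 V]
    [TopologicalSpace V] (P : HK.PairedLinearHKSpace.{u} 𝕜 V) :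
    (∀ γ γ' : C(unitInterval, V), HK.HasContinuousDeriv 𝕜 γ γ' →
      ∀ t : unitInterval, HK.curveIntegral P γ' t = γ t - γ 0) ∧
    (∀ γ : C(unitInterval, V), ∃ F : C(unitInterval, V),
      (∀ t : unitInterval, F t = HK.curveIntegral P γ t) ∧ HK.HasContinuousDeriv 𝕜 F γ) :=
  ⟨fun _ _ h t => h.curveIntegral_eq_sub P t, fun γ =>
    ⟨⟨HK.curveIntegral P γ, HK.continuous_curveIntegral P γ⟩, fun _ => rfl,
      HK.hasContinuousDeriv_curveIntegral P γ⟩⟩
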